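/- Let $d\ge 1$, let $\gamma>0$, and let $p:\mathbb C^d\to\mathbb C$ be an entire function of exponential type, i.e. $p$ is holomorphic on $\mathbb C^d$ and there are constants $C,\sigma>0$ such that $|p(z)|\le C e^{\sigma\sum_{j=1}^d|z_j|}$ for all $z\in\mathbb C^d$. Assume that $p$ is not identically zero, and let $\varphi(x)=p(x)e^{-\gamma\|x\|_2^2}$ for $x\in\mathbb R^d$. Then $\varphi\in L^2(\mathbb R^d)$. For $f\in L^2(\mathbb R^d)$ let $$V_\varphi f(x,\omega)=\int_{\mathbb R^d} f(t)\,\overline{\varphi(t-x)}\,e^{-2\pi i\,\omega\cdot t}\,dt,\qquad (x,\omega)\in\mathbb R^d\times\mathbb R^d,$$ denote the short-time Fourier transform of $f$ with window $\varphi$, and let $\sqrt{\mathbb Z}=\{\pm\sqrt n : n\in\mathbb N_0\}$. If $\alpha,\beta>0$ satisfy $$\alpha<\sqrt{\frac{1}{2\gamma e}},\qquad \beta<\sqrt{\frac{\gamma}{2\pi^2 e}},$$ then the following statements are equivalent for every $f,h\in L^2(\mathbb R^d)$: (1) $|V_\varphi f(\lambda)|=|V_\varphi h(\lambda)|$ for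 every $\lambda\in\alpha(\sqrt{\mathbb Z})^d\times\beta(\sqrt{\mathbb Z})^d$; (2) there is $\tau\in\mathbb C$ with $|\tau|=1$ such that $f=\tau h$. -/

import Mathlib

open MeasureTheory
open scoped Pointwise

noncomputable section

/-- The short-time Fourier transform
`V_g f (x, ω) = ∫ f(t) * conj (g (t - x)) * exp (-2πi ω · t) dt` on `ℝ^d`. -/
def stft {d : ℕ} (g f : EuclideanSpace ℝ (Fin d) → ℂ)
    (q : EuclideanSpace ℝ (Fin d) × EuclideanSpace ℝ (Fin d)) : ℂ :=
  ∫ t, f t * (starRingEnd ℂ) (g (t - q.1)) *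
    Complex.exp (-2 * (Real.pi : ℂ) * Complex.I * ((inner ℝ q.2 t : ℝ) : ℂ))

/-- `G : ℂ^d → ℂ` is an entire function of exponential type: it is holomorphic on `ℂ^d` and
`|G(z)| ≤ C exp (σ ‖z‖₁)` for some `C, σ > 0`. -/
def IsEntireOfExpType {d : ℕ} (G : (Fin d → ℂ) → ℂ) : Prop :=
  Differentiable ℂ G ∧
    ∃ σ : ℝ, 0 < σ ∧ ∃ C : ℝ, 0 < C ∧ ∀ z : Fin d → ℂ, ‖G z‖ ≤ C * Real.exp (σ * ∑ j, ‖z j‖)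

/-- The window `x ↦ p(x) exp (-γ ‖x‖₂²)` on `ℝ^d`. -/
def gaussWindow {d : ℕ} (γ : ℝ) (p : (Fin d → ℂ) → ℂ) (x : EuclideanSpace ℝ (Fin d)) : ℂ :=
  p (fun j => (x j : ℂ)) * (Real.exp (-γ * ‖x‖ ^ 2) : ℂ)

/-- `√ℤ = {±√n : n ∈ ℕ₀}`. -/
def sqrtInt : Set ℝ := {s | ∃ n : ℕ, s = √(n : ℝ) ∨ s = -√(n : ℝ)}

/-- `(√ℤ)^d` as a subset of `ℝ^d`. -/
def sqrtIntPow (d : ℕ) : Set (EuclideanSpace ℝ (Fin d)) := {x | ∀ j, x j ∈ sqrtInt}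

/-- `f ∼ h`: the elements `f, h` of `L²(ℝ^d)` agree up to a global phase. -/
def AgreeUpToPhase {d : ℕ}
    (f h : Lp ℂ 2 (volume : Measure (EuclideanSpace ℝ (Fin d)))) : Prop :=
  ∃ τ : ℂ, ‖τ‖ = 1 ∧ f = τ • h

end

/-! The implication from phase equality to equal moduli is immediate from linearity. The converse
has two halves, sampling and phase retrieval.

Sampling. The Gaussian factor lets $V_\varphi f$ extend to complex $(X,W)$, entire along complex
lines. On a line with real base point and real direction, $V(z)\overline{V(\bar z)}$ is then entire
and equals the spectrogram $|V|^2$ at real $z$. In a single time coordinate it grows like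
$e^{2\gamma|z|^2+O(|z|)}$, in a single frequency coordinate like $e^{(2\pi^2/\gamma)|z|^2+O(|z|)}$.
An entire function of growth $e^{A|z|^2}$ with zeros at all $\pm a\sqrt n$ vanishes when $eAa^2<1$
(`eq_zero_of_zeros_of_gaussian_growth`); for these two rates that is the condition on $\alpha$ and
on $\beta$. Applied to the difference of two spectrograms, one coordinate at a time, this gives
equality on all of $\mathbb R^d\times\mathbb R^d$ (`norm_stft_eq_of_eq_on_sqrtIntPow`).

Phase retrieval (`exists_phase_of_norm_stft_eq`). For fixed $x$ the spectrogram is the squared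
modulus of a Fourier transform, so it determines the autocorrelation of
$f\,\overline{\varphi(\cdot-x)}$. At shift $s$ this is, in $x$, a convolution of
$f\,\overline{f(\cdot-s)}$ with a product of translates of the window. That product has a Fourier
transform that is nonzero on a dense set, because $p\ne0$ is entire. Deconvolution yields
$f(t)\overline{f(t')}=h(t)\overline{h(t')}$ almost everywhere, hence $f=\tau h$. -/

/-! ### Uniqueness for entire functions vanishing at $\pm a\sqrt n$. -/

/-- Division of an entire function by a linear factor at a zero. -/
lemma exists_eq_sub_mul_of_zero {f : ℂ → ℂ} (hf : Differentiable ℂ f) {c : ℂ} (hc : f c = 0) :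
    ∃ g : ℂ → ℂ, Differentiable ℂ g ∧ ∀ z, f z = (z - c) * g z := by
  refine ⟨dslope f c, ?_, fun z => ?_⟩
  · rw [← differentiableOn_univ] at hf ⊢
    exact (Complex.differentiableOn_dslope Filter.univ_mem).2 hf
  · have := sub_smul_dslope f c z
    rw [hc, sub_zero, smul_eq_mul] at this
    exact this.symm

/-- The zeros are divided out in pairs $\pm a\sqrt{n+1}$. They are distinct, so earlier factors do
not vanish at later zeros, which therefore pass to the quotient. The zero at the origin is left
alone. -/
lemma exists_eq_prod_mul_of_zeros {f : ℂ → ℂ} (hf : Differentiable ℂ f) {a : ℝ} (ha : 0 < a)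
    (h1 : ∀ n : ℕ, f ((a * √n : ℝ) : ℂ) = 0) (h2 : ∀ n : ℕ, f ((-(a * √n) : ℝ) : ℂ) = 0) (N : ℕ) :
    ∃ g : ℂ → ℂ, Differentiable ℂ g ∧
      ∀ z, f z = (∏ n ∈ Finset.range N, (z ^ 2 - ((a ^ 2 * (n + 1) : ℝ) : ℂ))) * g z := by
  induction N with
  | zero => exact ⟨f, hf, by simp⟩
  | succ N ih =>
    obtain ⟨g, hg, hfg⟩ := ih
    set s : ℝ := a * √((N + 1 : ℕ) : ℝ) with hs
    have hspos : 0 < s := by positivity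
    have hs2 : s ^ 2 = a ^ 2 * (N + 1) := by
      rw [hs, mul_pow, Real.sq_sqrt (by positivity)]; push_cast; ring
    have hprod : ∀ w : ℝ, w ^ 2 = s ^ 2 →
        (∏ n ∈ Finset.range N, ((w : ℂ) ^ 2 - ((a ^ 2 * (n + 1) : ℝ) : ℂ))) ≠ 0 := by
      intro w hw
      rw [Finset.prod_ne_zero_iff]
      intro n hn
      rw [← Complex.ofReal_pow, hw, hs2, ← Complex.ofReal_sub, Complex.ofReal_ne_zero, ← mul_sub]
      have hn' : (n : ℝ) < N := by exact_mod_cast Finset.mem_range.1 hn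
      have : 0 < (N + 1 : ℝ) - (n + 1) := by linarith
      positivity
    have hg1 : g (s : ℂ) = 0 := by
      have := hfg s
      rw [h1 (N + 1)] at this
      exact (mul_eq_zero.1 this.symm).resolve_left (hprod s rfl)
    obtain ⟨g1, hg1d, hg1e⟩ := exists_eq_sub_mul_of_zero hg hg1
    have hg2 : g1 ((-s : ℝ) : ℂ) = 0 := by
      have := hfg ((-s : ℝ) : ℂ)
      rw [h2 (N + 1), hg1e] at this
      have h3 := (mul_eq_zero.1 this.symm).resolve_left (hprod (-s) (by ring))
      refine (mul_eq_zero.1 h3).resolve_left ?_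
      rw [← Complex.ofReal_sub]
      exact Complex.ofReal_ne_zero.2 (by linarith)
    obtain ⟨g2, hg2d, hg2e⟩ := exists_eq_sub_mul_of_zero hg1d hg2
    refine ⟨g2, hg2d, fun z => ?_⟩
    rw [hfg z, hg1e, hg2e, Finset.prod_range_succ, ← hs2]
    push_cast
    ring

/-- The inequality of arithmetic and geometric means for an arithmetic progression. -/
lemma prod_add_mul_le_pow {r b : ℝ} (hr : 0 ≤ r) (hb : 0 ≤ b) (N : ℕ) :
    ∏ n ∈ Finset.range N, (r + b * (n + 1)) ≤ (r + b * (N + 1) / 2) ^ N := by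
  have hnn : ∀ n ∈ Finset.range N, 0 ≤ r + b * ((n : ℝ) + 1) := fun n _ => by positivity
  have key : (∏ n ∈ Finset.range N, (r + b * ((n : ℝ) + 1))) ^ 2 ≤ ((r + b * (N + 1) / 2) ^ N) ^ 2 := by
    rw [sq, ← Finset.prod_range_reflect (fun n : ℕ => r + b * ((n : ℝ) + 1)) N]
    nth_rewrite 2 [Finset.prod_range_reflect (fun n : ℕ => r + b * ((n : ℝ) + 1)) N]
    rw [← Finset.prod_mul_distrib, ← pow_mul, mul_comm N 2, pow_mul]
    refine (Finset.prod_le_prod (g := fun _ => (r + b * (N + 1) / 2) ^ 2)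
      (fun n _ => by positivity) ?_).trans (by simp)
    intro n hn
    have hn' := Finset.mem_range.1 hn
    have : ((N - 1 - n : ℕ) : ℝ) = N - 1 - n := by
      rw [Nat.cast_sub (by omega), Nat.cast_sub (by omega)]; simp
    rw [this]
    nlinarith [sq_nonneg (b * (N - 1 - n - n : ℝ))]
  exact (sq_le_sq₀ (Finset.prod_nonneg hnn) (by positivity)).1 key

/-- Maximum principle for the quotient on the disc of radius $R$ with $R^2=ea^2N$: on its boundary
each of the $N$ factors is at least $(e-1)a^2N$, and $e^{AR^2}$ is the $N$-th power of $e^{eAa^2}$.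
-/
lemma norm_le_of_zeros_of_gaussian_growth {f : ℂ → ℂ} (hf : Differentiable ℂ f) {a : ℝ} (ha : 0 < a)
    (h1 : ∀ n : ℕ, f ((a * √n : ℝ) : ℂ) = 0) (h2 : ∀ n : ℕ, f ((-(a * √n) : ℝ) : ℂ) = 0)
    {K A : ℝ} (hbd : ∀ z, ‖f z‖ ≤ K * Real.exp (A * ‖z‖ ^ 2)) (z : ℂ) {N : ℕ} (hN : 0 < N)
    (hzN : ‖z‖ ^ 2 ≤ Real.exp 1 * a ^ 2 * N) :
    ‖f z‖ ≤ K * ((‖z‖ ^ 2 + a ^ 2 * (N + 1) / 2) / ((Real.exp 1 - 1) * a ^ 2 * N) *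
      Real.exp (Real.exp 1 * A * a ^ 2)) ^ N := by
  obtain ⟨g, hg, hfg⟩ := exists_eq_prod_mul_of_zeros hf ha h1 h2 N
  have he : (2 : ℝ) < Real.exp 1 := by linarith [Real.exp_one_gt_d9]
  have hN' : (0 : ℝ) < N := by exact_mod_cast hN
  set R : ℝ := √(Real.exp 1 * a ^ 2 * N) with hR
  have hRpos : 0 < R := by positivity
  have hR2 : R ^ 2 = Real.exp 1 * a ^ 2 * N := Real.sq_sqrt (by positivity)
  have hD : 0 < (Real.exp 1 - 1) * a ^ 2 * N := by
    have : 0 < Real.exp 1 - 1 := by linarith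
    positivity
  have hK : 0 ≤ K := by
    have := (norm_nonneg _).trans (hbd 0)
    exact nonneg_of_mul_nonneg_left this (Real.exp_pos _)
  have hgbd : ∀ w : ℂ, ‖w‖ = R → ‖g w‖ ≤ K * Real.exp (A * R ^ 2) / ((Real.exp 1 - 1) * a ^ 2 * N) ^ N := by
    intro w hw
    rw [le_div_iff₀ (by positivity)]
    have h3 := hbd w
    rw [hfg w, norm_mul, hw, mul_comm] at h3
    refine (mul_le_mul_of_nonneg_left ?_ (norm_nonneg _)).trans h3
    rw [norm_prod]
    refine le_trans (by simp) (Finset.prod_le_prod (s := Finset.range N)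
      (f := fun _ => (Real.exp 1 - 1) * a ^ 2 * N) (fun _ _ => hD.le) ?_)
    intro n hn
    have hn' : (n : ℝ) + 1 ≤ N := by exact_mod_cast Finset.mem_range.1 hn
    have h4 := norm_sub_norm_le (w ^ 2) ((a ^ 2 * (n + 1) : ℝ) : ℂ)
    rw [norm_pow, hw, hR2, Complex.norm_real, Real.norm_of_nonneg (by positivity)] at h4
    refine le_trans ?_ h4
    have : a ^ 2 * (n + 1 : ℝ) ≤ a ^ 2 * N := by gcongr
    linarith
  have hz : ‖z‖ ≤ R := by
    rw [hR]; exact Real.le_sqrt_of_sq_le hzN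
  have hgz := Complex.norm_le_of_forall_mem_frontier_norm_le (U := Metric.ball (0 : ℂ) R)
    Metric.isBounded_ball hg.diffContOnCl
    (C := K * Real.exp (A * R ^ 2) / ((Real.exp 1 - 1) * a ^ 2 * N) ^ N)
    (by
      rw [frontier_ball _ hRpos.ne']
      intro w hw
      exact hgbd w (by simpa using hw))
    (z := z) (by rw [closure_ball _ hRpos.ne']; simpa using hz)
  have hp : ‖∏ n ∈ Finset.range N, (z ^ 2 - ((a ^ 2 * (n + 1) : ℝ) : ℂ))‖ ≤
      (‖z‖ ^ 2 + a ^ 2 * (N + 1) / 2) ^ N := by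
    refine le_trans ?_ (prod_add_mul_le_pow (sq_nonneg _) (sq_nonneg a) N)
    rw [norm_prod]
    refine Finset.prod_le_prod (fun _ _ => norm_nonneg _) fun n _ => ?_
    refine (norm_sub_le _ _).trans (le_of_eq ?_)
    rw [norm_pow, Complex.norm_real, Real.norm_of_nonneg (by positivity)]
  rw [hfg z, norm_mul]
  calc _ ≤ (‖z‖ ^ 2 + a ^ 2 * (N + 1) / 2) ^ N *
        (K * Real.exp (A * R ^ 2) / ((Real.exp 1 - 1) * a ^ 2 * N) ^ N) := by gcongr
    _ = _ := by
        have : Real.exp (A * R ^ 2) = Real.exp (Real.exp 1 * A * a ^ 2) ^ N := by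
          rw [← Real.exp_nat_mul, hR2]; congr 1; ring
        rw [this, mul_pow _ (Real.exp _), div_pow]; ring

/-- An entire function of Gaussian growth vanishing on a sufficiently dense square-root lattice
vanishes identically. -/
lemma eq_zero_of_zeros_of_gaussian_growth {f : ℂ → ℂ} (hf : Differentiable ℂ f) {a : ℝ} (ha : 0 < a)
    (h1 : ∀ n : ℕ, f ((a * √n : ℝ) : ℂ) = 0) (h2 : ∀ n : ℕ, f ((-(a * √n) : ℝ) : ℂ) = 0)
    {K A : ℝ} (hA : Real.exp 1 * A * a ^ 2 < 1)
    (hbd : ∀ z, ‖f z‖ ≤ K * Real.exp (A * ‖z‖ ^ 2)) (z : ℂ) : f z = 0 := by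
  have he : (2 : ℝ) < Real.exp 1 := by linarith [Real.exp_one_gt_d9]
  have hK : 0 ≤ K := by
    have := (norm_nonneg _).trans (hbd 0)
    exact nonneg_of_mul_nonneg_left this (Real.exp_pos _)
  have ht : Filter.Tendsto (fun N : ℕ => (‖z‖ ^ 2 + a ^ 2 * ((N : ℝ) + 1) / 2) /
      ((Real.exp 1 - 1) * a ^ 2 * N) * Real.exp (Real.exp 1 * A * a ^ 2)) Filter.atTop
      (nhds (1 / (2 * (Real.exp 1 - 1)) * Real.exp (Real.exp 1 * A * a ^ 2))) := by
    refine Filter.Tendsto.mul_const _ ?_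
    have h3 : Filter.Tendsto (fun N : ℕ => (‖z‖ ^ 2 + a ^ 2 / 2) / ((Real.exp 1 - 1) * a ^ 2) *
        (1 / (N : ℝ)) + 1 / (2 * (Real.exp 1 - 1))) Filter.atTop
        (nhds ((‖z‖ ^ 2 + a ^ 2 / 2) / ((Real.exp 1 - 1) * a ^ 2) * 0 +
          1 / (2 * (Real.exp 1 - 1)))) :=
      (tendsto_one_div_atTop_nhds_zero_nat.const_mul _).add_const _
    rw [mul_zero, zero_add] at h3
    refine h3.congr' ?_
    filter_upwards [Filter.eventually_gt_atTop 0] with N hN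
    have hN' : (0 : ℝ) < N := by exact_mod_cast hN
    have : Real.exp 1 - 1 ≠ 0 := by linarith
    field_simp
    ring
  -- Here $e^{eAa^2}<e<2(e-1)$, the last inequality because $e>2$; the bound thus decays
  -- geometrically in $N$.
  have hlim : 1 / (2 * (Real.exp 1 - 1)) * Real.exp (Real.exp 1 * A * a ^ 2) < 1 := by
    have h4 : Real.exp (Real.exp 1 * A * a ^ 2) < Real.exp 1 := Real.exp_lt_exp.2 hA
    rw [one_div, inv_mul_lt_iff₀ (by linarith)]
    linarith
  obtain ⟨q, hq1, hq2⟩ := exists_between hlim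
  have hq0 : 0 ≤ q := by
    refine le_trans ?_ hq1.le
    have : 0 < Real.exp 1 - 1 := by linarith
    positivity
  have hlarge : ∀ᶠ N : ℕ in Filter.atTop, ‖z‖ ^ 2 ≤ Real.exp 1 * a ^ 2 * N :=
    (tendsto_natCast_atTop_atTop.const_mul_atTop (by positivity)).eventually_ge_atTop _
  have hle : ∀ᶠ N : ℕ in Filter.atTop, ‖f z‖ ≤ K * q ^ N := by
    filter_upwards [hlarge, ht.eventually_lt_const hq1, Filter.eventually_gt_atTop 0]
      with N h5 h6 h7
    refine (norm_le_of_zeros_of_gaussian_growth hf ha h1 h2 hbd z h7 h5).trans ?_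
    have : 0 < Real.exp 1 - 1 := by linarith
    gcongr
  have h8 := ge_of_tendsto ((tendsto_pow_atTop_nhds_zero_of_lt_one hq0 hq2).const_mul K) hle
  rw [mul_zero] at h8
  exact norm_le_zero_iff.1 h8

lemma eq_zero_of_zeros_of_growth {f : ℂ → ℂ} (hf : Differentiable ℂ f) {a : ℝ} (ha : 0 < a)
    (h1 : ∀ n : ℕ, f ((a * √n : ℝ) : ℂ) = 0) (h2 : ∀ n : ℕ, f ((-(a * √n) : ℝ) : ℂ) = 0)
    {K A B : ℝ} (hA : Real.exp 1 * A * a ^ 2 < 1)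
    (hbd : ∀ z, ‖f z‖ ≤ K * Real.exp (A * ‖z‖ ^ 2 + B * ‖z‖)) (z : ℂ) : f z = 0 := by
  have hK : 0 ≤ K := by
    have := (norm_nonneg _).trans (hbd 0)
    exact nonneg_of_mul_nonneg_left this (Real.exp_pos _)
  -- The linear term is absorbed by $B|w|\le\delta|w|^2+B^2/(4\delta)$; this $\delta$ puts
  -- $e(A+\delta)a^2$ midway between $eAa^2$ and $1$.
  set δ : ℝ := (1 - Real.exp 1 * A * a ^ 2) / (2 * Real.exp 1 * a ^ 2) with hδ
  have hδ0 : 0 < δ := by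
    have : 0 < 1 - Real.exp 1 * A * a ^ 2 := by linarith
    positivity
  refine eq_zero_of_zeros_of_gaussian_growth hf ha h1 h2 (K := K * Real.exp (B ^ 2 / (4 * δ)))
    (A := A + δ) ?_ (fun w => ?_) z
  · have : Real.exp 1 * (A + δ) * a ^ 2 = (1 + Real.exp 1 * A * a ^ 2) / 2 := by
      rw [hδ]; field_simp; ring
    rw [this]; linarith
  · refine (hbd w).trans ?_
    rw [mul_assoc, ← Real.exp_add]
    refine mul_le_mul_of_nonneg_left (Real.exp_le_exp.2 ?_) hK
    have h3 : B ^ 2 / (4 * δ) + δ * ‖w‖ ^ 2 - B * ‖w‖ = (B - 2 * δ * ‖w‖) ^ 2 / (4 * δ) := by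
      field_simp; ring
    have h4 : 0 ≤ (B - 2 * δ * ‖w‖) ^ 2 / (4 * δ) := by positivity
    linarith

/-! ### Injectivity of the Fourier transform, autocorrelation and deconvolution. -/

section FourierUniqueness

open scoped FourierTransform Convolution SchwartzMap ContDiff ComplexConjugate

variable {E : Type*} [NormedAddCommGroup E] [InnerProductSpace ℝ E] [FiniteDimensional ℝ E]
  [MeasurableSpace E] [BorelSpace E]

lemma integral_schwartz_mul_eq_integral_fourierInv_mul {u : E → ℂ} (hu : Integrable u)
    (ψ : 𝓢(E, ℂ)) : ∫ x, ψ x * u x = ∫ ξ, (𝓕⁻ ψ) ξ * 𝓕 u ξ := by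
  have h := VectorFourier.integral_fourierIntegral_smul_eq_flip (e := Real.fourierChar)
    (L := innerₗ E) (μ := (volume : Measure E)) (ν := (volume : Measure E))
    Real.continuous_fourierChar (by exact continuous_inner) (𝓕⁻ ψ).integrable hu
  have h1 : VectorFourier.fourierIntegral Real.fourierChar volume (innerₗ E) (𝓕⁻ ψ : 𝓢(E, ℂ)) =
      ψ := by
    have h2 : 𝓕 (𝓕⁻ ψ : 𝓢(E, ℂ)) = ψ := FourierTransform.fourier_fourierInv_eq ψ
    conv_rhs => rw [← h2, SchwartzMap.fourier_coe]
    rfl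
  rw [h1, flip_innerₗ] at h
  exact h

/-- The Fourier transform is injective on integrable functions. -/
lemma ae_eq_of_fourier_eq {u v : E → ℂ} (hu : Integrable u) (hv : Integrable v)
    (h : ∀ ξ, 𝓕 u ξ = 𝓕 v ξ) : u =ᵐ[volume] v := by
  refine ae_eq_of_integral_contDiff_smul_eq hu.locallyIntegrable hv.locallyIntegrable ?_
  intro g g_smooth g_cpt
  have hg₁ : HasCompactSupport (Complex.ofRealCLM ∘ g) := g_cpt.comp_left rfl
  have hg₂ : ContDiff ℝ ∞ (Complex.ofRealCLM ∘ g) := by fun_prop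
  have h1 := integral_schwartz_mul_eq_integral_fourierInv_mul hu (hg₁.toSchwartzMap hg₂)
  have h2 := integral_schwartz_mul_eq_integral_fourierInv_mul hv (hg₁.toSchwartzMap hg₂)
  simp_rw [h] at h1
  rw [← h2] at h1
  simpa using h1

lemma continuous_fourier_of_integrable {u : E → ℂ} (hu : Integrable u) : Continuous (𝓕 u) :=
  VectorFourier.fourierIntegral_continuous Real.continuous_fourierChar
    (by exact continuous_inner) hu

lemma fourier_conj_neg (u : E → ℂ) (ξ : E) :
    𝓕 (fun t => conj (u (-t))) ξ = conj (𝓕 u ξ) := by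
  rw [Real.fourier_eq', Real.fourier_eq', ← integral_conj,
    ← integral_neg_eq_self (fun v => conj (Complex.exp _ • u v))]
  congr 1 with v
  simp [← Complex.exp_conj, Complex.conj_ofNat]

lemma integrable_conj_neg {u : E → ℂ} (hu : Integrable u) :
    Integrable (fun t => conj (u (-t))) :=
  (Complex.conjLIE.toContinuousLinearEquiv.integrable_comp_iff).2 hu.comp_neg

/-- The modulus of the Fourier transform determines the autocorrelation. -/
lemma autocorrelation_ae_eq {u v : E → ℂ} (hu : Integrable u) (hv : Integrable v)
    (h : ∀ ξ, ‖𝓕 u ξ‖ = ‖𝓕 v ξ‖) :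
    ∀ᵐ s, ∫ t, u t * conj (u (t - s)) = ∫ t, v t * conj (v (t - s)) := by
  have key : ∀ {w : E → ℂ}, Integrable w → ∀ ξ,
      𝓕 (w ⋆[ContinuousLinearMap.mul ℂ ℂ] (fun t => conj (w (-t)))) ξ = ((‖𝓕 w ξ‖ ^ 2 : ℝ) : ℂ) := by
    intro w hw ξ
    rw [Real.fourier_mul_convolution_eq hw (integrable_conj_neg hw), fourier_conj_neg,
      Complex.mul_conj, Complex.normSq_eq_norm_sq]
  have h1 := ae_eq_of_fourier_eq
    (hu.integrable_convolution (ContinuousLinearMap.mul ℂ ℂ) (integrable_conj_neg hu))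
    (hv.integrable_convolution (ContinuousLinearMap.mul ℂ ℂ) (integrable_conj_neg hv))
    (fun ξ => by rw [key hu, key hv, h])
  filter_upwards [h1] with s hs
  simpa [convolution] using hs

/-- Deconvolution: a convolution determines one factor if the Fourier transform of the other one
is nonzero on a dense set. -/
lemma ae_eq_of_convolution_ae_eq {u v w : E → ℂ} (hu : Integrable u) (hv : Integrable v)
    (hw : Integrable w) (hd : Dense {ξ | 𝓕 w ξ ≠ 0})
    (h : ∀ᵐ x, ∫ t, u t * w (x - t) = ∫ t, v t * w (x - t)) : u =ᵐ[volume] v := by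
  have h1 : (u ⋆[ContinuousLinearMap.mul ℂ ℂ] w) =ᵐ[volume]
      (v ⋆[ContinuousLinearMap.mul ℂ ℂ] w) := by
    filter_upwards [h] with x hx
    simpa [convolution] using hx
  have h2 : ∀ ξ, 𝓕 u ξ * 𝓕 w ξ = 𝓕 v ξ * 𝓕 w ξ := by
    intro ξ
    rw [← Real.fourier_mul_convolution_eq hu hw, ← Real.fourier_mul_convolution_eq hv hw,
      Real.fourier_eq', Real.fourier_eq']
    refine integral_congr_ae ?_
    filter_upwards [h1] with x hx
    rw [hx]
  refine ae_eq_of_fourier_eq hu hv (congrFun ?_)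
  refine Continuous.ext_on hd (continuous_fourier_of_integrable hu)
    (continuous_fourier_of_integrable hv) fun ξ hξ => ?_
  exact mul_right_cancel₀ hξ (h2 ξ)

end FourierUniqueness

/-! ### Rank-one kernels and the global phase. -/

section GlobalPhase

open scoped ComplexConjugate

/-- Functions with the same rank-one kernel agree up to a global phase. -/
lemma exists_phase_of_kernel_eq {X : Type*} [MeasurableSpace X] {μ : Measure X} {f h : X → ℂ}
    (H : ∀ᵐ t ∂μ, ∀ᵐ t' ∂μ, f t * conj (f t') = h t * conj (h t')) :
    ∃ τ : ℂ, ‖τ‖ = 1 ∧ f =ᵐ[μ] fun t => τ * h t := by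
  by_cases hf : f =ᵐ[μ] 0
  · refine ⟨1, norm_one, ?_⟩
    by_cases hh : h =ᵐ[μ] 0
    · filter_upwards [hf, hh] with t h1 h2
      simp [h1, h2]
    · exfalso
      obtain ⟨t, ht0, ht⟩ := (Filter.not_eventually.1 hh).and_eventually H |>.exists
      refine hh ?_
      filter_upwards [ht, hf] with t' h1 h2
      rw [h2, Pi.zero_apply, map_zero, mul_zero] at h1
      simpa using (mul_eq_zero.1 h1.symm).resolve_left ht0
  · have key : ∀ t, f t ≠ 0 → (∀ᵐ t' ∂μ, f t * conj (f t') = h t * conj (h t')) →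
        f =ᵐ[μ] fun t' => conj (h t / f t) * h t' := by
      intro t ht0 ht
      filter_upwards [ht] with t' h1
      have h2 := congrArg conj h1
      simp only [map_mul, Complex.conj_conj] at h2
      have h3 : conj (f t) ≠ 0 := by simpa using ht0
      rw [map_div₀, div_mul_eq_mul_div, eq_div_iff h3, mul_comm, h2]
    obtain ⟨t, ht0, ht⟩ := (Filter.not_eventually.1 hf).and_eventually H |>.exists
    have ht0' : f t ≠ 0 := ht0
    have h4 := key t ht0' ht
    refine ⟨_, ?_, h4⟩
    set τ := conj (h t / f t)
    -- At two points where $f\ne0$, the kernel identity and $f=\tau h$ together force $|\tau|^2=1$.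
    obtain ⟨r, hr0, hr, hrτ⟩ := (Filter.not_eventually.1 hf).and_eventually (H.and h4) |>.exists
    obtain ⟨q, hq0, hq, hqτ⟩ := (Filter.not_eventually.1 hf).and_eventually (hr.and h4) |>.exists
    have hrτ' : f r = τ * h r := hrτ
    have hqτ' : f q = τ * h q := hqτ
    have hr1 : τ * h r ≠ 0 := hrτ' ▸ hr0
    have hq1 : τ * h q ≠ 0 := hqτ' ▸ hq0
    have h5 := congrArg norm hq
    rw [hrτ', hqτ'] at h5
    simp only [norm_mul, RCLike.norm_conj] at h5
    have h6 : 0 < ‖h r‖ * ‖h q‖ :=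
      mul_pos (norm_pos_iff.2 (right_ne_zero_of_mul hr1)) (norm_pos_iff.2 (right_ne_zero_of_mul hq1))
    have h7 : ‖τ‖ ^ 2 = 1 := mul_right_cancel₀ h6.ne' (by linarith)
    exact (pow_eq_one_iff_of_nonneg (norm_nonneg _) two_ne_zero).1 h7

end GlobalPhase

/-! ### Phase retrieval from the full spectrogram. -/

section PhaseRetrieval

open scoped FourierTransform ComplexConjugate

variable {d : ℕ}

lemma stft_eq_fourier (g f : EuclideanSpace ℝ (Fin d) → ℂ) (x ω : EuclideanSpace ℝ (Fin d)) :
    stft g f (x, ω) = 𝓕 (fun t => f t * conj (g (t - x))) ω := by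
  rw [stft, Real.fourier_eq']
  congr 1 with t
  rw [smul_eq_mul, mul_comm, real_inner_comm]
  congr 2
  push_cast
  ring

lemma memLp_conj_comp_sub_right {g : EuclideanSpace ℝ (Fin d) → ℂ} (hg : MemLp g 2)
    (x : EuclideanSpace ℝ (Fin d)) : MemLp (fun t => conj (g (t - x))) 2 :=
  (hg.comp_measurePreserving (measurePreserving_sub_right volume x)).star

lemma integrable_mul_conj_comp_sub_right {f g : EuclideanSpace ℝ (Fin d) → ℂ} (hf : MemLp f 2)
    (hg : MemLp g 2) (x : EuclideanSpace ℝ (Fin d)) :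
    Integrable (fun t => f t * conj (g (t - x))) :=
  hf.integrable_mul (memLp_conj_comp_sub_right hg x)

/-- Equality of the STFT moduli gives, for almost every shift `s`, equality of the
`x`-convolutions of the correlation products of `f` and `h`. -/
lemma correlation_convolution_ae_eq {φ f h : EuclideanSpace ℝ (Fin d) → ℂ}
    (hφm : StronglyMeasurable φ) (hfm : StronglyMeasurable f) (hhm : StronglyMeasurable h)
    (hφ : MemLp φ 2) (hf : MemLp f 2) (hh : MemLp h 2)
    (H : ∀ x ω, ‖stft φ f (x, ω)‖ = ‖stft φ h (x, ω)‖) :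
    ∀ᵐ s, ∀ᵐ x, ∫ t, f t * conj (f (t - s)) * (φ (-(x - t) - s) * conj (φ (-(x - t)))) =
      ∫ t, h t * conj (h (t - s)) * (φ (-(x - t) - s) * conj (φ (-(x - t)))) := by
  have hmeas : ∀ {u : EuclideanSpace ℝ (Fin d) → ℂ}, StronglyMeasurable u →
      StronglyMeasurable fun q : EuclideanSpace ℝ (Fin d) × EuclideanSpace ℝ (Fin d) =>
        ∫ t, u t * conj (u (t - q.2)) * (φ (-(q.1 - t) - q.2) * conj (φ (-(q.1 - t)))) := by
    intro u hu
    refine StronglyMeasurable.integral_prod_right' (f := fun r : (EuclideanSpace ℝ (Fin d) ×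
      EuclideanSpace ℝ (Fin d)) × EuclideanSpace ℝ (Fin d) =>
        u r.2 * conj (u (r.2 - r.1.2)) * (φ (-(r.1.1 - r.2) - r.1.2) * conj (φ (-(r.1.1 - r.2))))) ?_
    have hc : Continuous (conj : ℂ → ℂ) := Complex.continuous_conj
    exact ((hu.comp_measurable measurable_snd).mul
      (hc.comp_stronglyMeasurable (hu.comp_measurable (by fun_prop)))).mul
      ((hφm.comp_measurable (by fun_prop)).mul
        (hc.comp_stronglyMeasurable (hφm.comp_measurable (by fun_prop))))
  -- The autocorrelation identity holds for every $x$ and almost every $s$; joint measurability lets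
  -- Fubini exchange the quantifiers, so that $s$ can be fixed and the identity read as a
  -- convolution in $x$.
  refine (Measure.ae_ae_comm (p := fun x s =>
    ∫ t, f t * conj (f (t - s)) * (φ (-(x - t) - s) * conj (φ (-(x - t)))) =
      ∫ t, h t * conj (h (t - s)) * (φ (-(x - t) - s) * conj (φ (-(x - t))))) ?_).1 ?_
  · exact measurableSet_eq_fun (hmeas hfm).measurable (hmeas hhm).measurable
  · refine Filter.Eventually.of_forall fun x => ?_
    have h1 := autocorrelation_ae_eq (integrable_mul_conj_comp_sub_right hf hφ x)
      (integrable_mul_conj_comp_sub_right hh hφ x)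
      (fun ξ => by rw [← stft_eq_fourier, ← stft_eq_fourier, H])
    filter_upwards [h1] with s hs
    convert hs using 3 with t t
    all_goals
      rw [neg_sub, sub_right_comm t x s]
      simp only [map_mul, Complex.conj_conj]
      ring

/-- Phase retrieval from the full spectrogram: if the ambiguity function of the window is densely
nonzero in the frequency variable for every shift, the spectrogram determines a signal up to a
global phase. -/
theorem exists_phase_of_norm_stft_eq {φ f h : EuclideanSpace ℝ (Fin d) → ℂ}
    (hφm : StronglyMeasurable φ) (hfm : StronglyMeasurable f) (hhm : StronglyMeasurable h)
    (hφ : MemLp φ 2) (hf : MemLp f 2) (hh : MemLp h 2)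
    (hd : ∀ s, Dense {ω | stft φ (fun y => φ (y - s)) (0, ω) ≠ 0})
    (H : ∀ x ω, ‖stft φ f (x, ω)‖ = ‖stft φ h (x, ω)‖) :
    ∃ τ : ℂ, ‖τ‖ = 1 ∧ f =ᵐ[volume] fun t => τ * h t := by
  have hc : Continuous (conj : ℂ → ℂ) := Complex.continuous_conj
  have h1 : ∀ᵐ s, ∀ᵐ t, f t * conj (f (t - s)) = h t * conj (h (t - s)) := by
    filter_upwards [correlation_convolution_ae_eq hφm hfm hhm hφ hf hh H] with s hs
    have hφs : MemLp (fun y => φ (y - s)) 2 :=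
      hφ.comp_measurePreserving (measurePreserving_sub_right volume s)
    have hw : Integrable (fun y => φ (y - s) * conj (φ y)) := by
      simpa using integrable_mul_conj_comp_sub_right hφs hφ 0
    refine ae_eq_of_convolution_ae_eq (integrable_mul_conj_comp_sub_right hf hf s)
      (integrable_mul_conj_comp_sub_right hh hh s)
      (w := fun y => φ (-y - s) * conj (φ (-y))) hw.comp_neg ?_ hs
    have h2 : ∀ ξ, 𝓕 (fun y => φ (-y - s) * conj (φ (-y))) ξ =
        stft φ (fun y => φ (y - s)) (0, -ξ) := by
      intro ξ
      rw [stft_eq_fourier, Real.fourier_eq', Real.fourier_eq',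
        ← integral_neg_eq_self (fun v => Complex.exp _ • (φ (v - s) * conj (φ (v - 0))))]
      simp
    simp_rw [h2]
    exact (hd s).preimage (Homeomorph.neg (EuclideanSpace ℝ (Fin d))).isOpenMap
  have h2 := (Measure.ae_ae_comm (p := fun s t => f t * conj (f (t - s)) = h t * conj (h (t - s)))
    (measurableSet_eq_fun
      ((hfm.comp_measurable measurable_snd).mul
        (hc.comp_stronglyMeasurable (hfm.comp_measurable (by fun_prop)))).measurable
      ((hhm.comp_measurable measurable_snd).mul
        (hc.comp_stronglyMeasurable (hhm.comp_measurable (by fun_prop)))).measurable)).1 h1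
  refine exists_phase_of_kernel_eq ?_
  filter_upwards [h2] with t ht
  -- Substituting $s=t-t'$ turns the shift identity into a kernel identity in $(t,t')$.
  have h3 := (Measure.measurePreserving_sub_left volume t).quasiMeasurePreserving.ae ht
  simpa using h3

end PhaseRetrieval

/-! ### Entire functions: parameter integrals and the identity theorem on real lines. -/

section EntireTools

open scoped Topology

/-- A dominated integral of entire functions is entire. -/
lemma differentiable_integral_of_locally_dominated {X : Type*} [MeasurableSpace X] {μ : Measure X}
    {H : ℂ → X → ℂ} (hH : ∀ t, Differentiable ℂ fun z => H z t)
    (hm : ∀ z, AEStronglyMeasurable (H z) μ)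
    (hb : ∀ R : ℝ, ∃ B : X → ℝ, Integrable B μ ∧ ∀ z, ‖z‖ ≤ R → ∀ t, ‖H z t‖ ≤ B t) :
    Differentiable ℂ fun z => ∫ t, H z t ∂μ := by
  intro z
  -- The margin $2$ leaves room for the unit ball around $z$ and, for Cauchy's estimate of the
  -- derivative, unit circles around its points.
  obtain ⟨B, hB, hHB⟩ := hb (‖z‖ + 2)
  -- Measurability of the derivative in $t$ comes from a sequence of difference quotients.
  have hderiv : ∀ t, Filter.Tendsto (fun n : ℕ => ((1 / ((n : ℝ) + 1) : ℝ) : ℂ)⁻¹ •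
      (H (z + ((1 / ((n : ℝ) + 1) : ℝ) : ℂ)) t - H z t)) Filter.atTop
      (𝓝 (deriv (fun w => H w t) z)) := by
    intro t
    refine ((hH t z).hasDerivAt.tendsto_slope_zero).comp ?_
    refine tendsto_nhdsWithin_iff.2 ⟨?_, Filter.Eventually.of_forall fun n => ?_⟩
    · have := (Complex.continuous_ofReal.tendsto 0).comp
        (tendsto_one_div_add_atTop_nhds_zero_nat (𝕜 := ℝ))
      simpa [Function.comp_def] using this
    · have : (1 / ((n : ℝ) + 1) : ℝ) ≠ 0 := by positivity
      exact Complex.ofReal_ne_zero.2 this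
  refine (hasDerivAt_integral_of_dominated_loc_of_deriv_le (F' := fun w t => deriv (fun w => H w t) w)
    (bound := B) (Metric.ball_mem_nhds z one_pos) (Filter.Eventually.of_forall hm)
    (hB.mono' (hm z) (Filter.Eventually.of_forall fun t => hHB z (by linarith) t)) ?_ ?_ hB ?_).2
    |>.differentiableAt
  · refine aestronglyMeasurable_of_tendsto_ae Filter.atTop (fun n => ?_)
      (Filter.Eventually.of_forall hderiv)
    exact ((hm (z + ((1 / ((n : ℝ) + 1) : ℝ) : ℂ))).sub (hm z)).const_smul
      (((1 / ((n : ℝ) + 1) : ℝ) : ℂ)⁻¹)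
  · refine Filter.Eventually.of_forall fun t w hw => ?_
    have := Complex.norm_deriv_le_of_forall_mem_sphere_norm_le (c := w) (C := B t) one_pos
      (hH t).diffContOnCl fun y hy => hHB y ?_ t
    · simpa using this
    · have h1 : ‖y - w‖ = 1 := by simpa using hy
      have h2 : ‖w - z‖ < 1 := by simpa [dist_eq_norm] using hw
      have h3 : y = (y - w) + (w - z) + z := by ring
      rw [h3]
      exact (norm_add₃_le).trans (by linarith)
  · exact Filter.Eventually.of_forall fun t w _ => (hH t w).hasDerivAt

lemma eq_zero_of_eventually_real {g : ℂ → ℂ} (hg : Differentiable ℂ g)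
    (h : ∀ᶠ r : ℝ in 𝓝 0, g r = 0) : g = 0 := by
  refine AnalyticOnNhd.eq_of_frequently_eq (z₀ := 0) (fun z _ => hg.analyticAt z)
    analyticOnNhd_const ?_
  have h1 : Filter.Tendsto (fun r : ℝ => (r : ℂ)) (𝓝[≠] 0) (𝓝[≠] 0) := by
    refine tendsto_nhdsWithin_iff.2 ⟨?_, ?_⟩
    · exact ((Complex.continuous_ofReal.tendsto' 0 0 (by simp))).mono_left nhdsWithin_le_nhds
    · filter_upwards [self_mem_nhdsWithin] with r hr
      exact Complex.ofReal_ne_zero.2 hr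
  refine h1.frequently (Filter.Eventually.frequently ?_)
  exact h.filter_mono nhdsWithin_le_nhds

/-- A function with entire restrictions to all real lines is nonzero on a dense set, unless it
vanishes identically. -/
lemma dense_ne_zero_of_entire_lines {E : Type*} [NormedAddCommGroup E] [NormedSpace ℝ E]
    {Q : E → ℂ} (hQ : ∀ x v, ∃ g : ℂ → ℂ, Differentiable ℂ g ∧ ∀ r : ℝ, g r = Q (x + r • v))
    (hne : ∃ x, Q x ≠ 0) : Dense {x | Q x ≠ 0} := by
  obtain ⟨y, hy⟩ := hne
  intro x
  by_contra hx
  obtain ⟨g, hg, hgQ⟩ := hQ x (y - x)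
  have h1 : ∀ᶠ z in 𝓝 x, Q z = 0 := by
    rw [mem_closure_iff_frequently] at hx
    simpa using hx
  have h2 : Filter.Tendsto (fun r : ℝ => x + r • (y - x)) (𝓝 0) (𝓝 x) := by
    have : Continuous fun r : ℝ => x + r • (y - x) := by fun_prop
    simpa using this.tendsto 0
  have h3 := eq_zero_of_eventually_real hg ((h2.eventually h1).mono fun r hr => by rw [hgQ, hr])
  apply hy
  have h4 := hgQ 1
  rw [h3] at h4
  simpa using h4.symm

end EntireTools

/-! ### Extension of the STFT to complex time and frequency, with growth bounds. -/

section ComplexifiedSTFT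

open scoped ComplexConjugate FourierTransform

variable {d : ℕ}

/-- The integrand of the complexified STFT with window `gaussWindow γ p`, without the signal. -/
noncomputable def stftKernel (γ : ℝ) (p : (Fin d → ℂ) → ℂ) (X W : Fin d → ℂ)
    (t : EuclideanSpace ℝ (Fin d)) : ℂ :=
  conj (p fun j => (t j : ℂ) - conj (X j)) *
    Complex.exp (∑ j, (-γ * ((t j : ℂ) - X j) ^ 2 - 2 * Real.pi * Complex.I * (W j * t j)))

/-- The extension of the STFT with window `gaussWindow γ p` to complex time and frequency. -/
noncomputable def stftComplex (γ : ℝ) (p : (Fin d → ℂ) → ℂ) (f : EuclideanSpace ℝ (Fin d) → ℂ)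
    (X W : Fin d → ℂ) : ℂ :=
  ∫ t, f t * stftKernel γ p X W t

lemma stftComplex_ofReal (γ : ℝ) (p : (Fin d → ℂ) → ℂ) (f : EuclideanSpace ℝ (Fin d) → ℂ)
    (x ω : EuclideanSpace ℝ (Fin d)) :
    stftComplex γ p f (fun j => (x j : ℂ)) (fun j => (ω j : ℂ)) = stft (gaussWindow γ p) f (x, ω) := by
  rw [stftComplex, stft]
  congr 1 with t
  have h1 : ∑ j, (-γ * ((t j : ℂ) - x j) ^ 2 - 2 * Real.pi * Complex.I * (ω j * t j)) =
      ((-γ * ‖t - x‖ ^ 2 : ℝ) : ℂ) + -2 * Real.pi * Complex.I * ((inner ℝ ω t : ℝ) : ℂ) := by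
    rw [Finset.sum_sub_distrib, ← Finset.mul_sum, ← Finset.mul_sum, EuclideanSpace.real_norm_sq_eq,
      PiLp.inner_apply]
    simp only [RCLike.inner_apply, conj_trivial, PiLp.sub_apply, mul_comm (t _)]
    push_cast
    ring
  rw [stftKernel, gaussWindow, h1, Complex.exp_add]
  rw [map_mul, Complex.conj_ofReal, Complex.ofReal_exp]
  simp only [PiLp.sub_apply, Complex.ofReal_sub, Complex.conj_ofReal]
  ring

/-- The point around which the complexified STFT integrand is concentrated. -/
noncomputable def kernelCenter (γ : ℝ) (X W : Fin d → ℂ) : EuclideanSpace ℝ (Fin d) :=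
  WithLp.toLp 2 fun j => (X j).re + Real.pi / γ * (W j).im

/-- The logarithmic growth rate of the complexified STFT. -/
noncomputable def kernelGrowth (γ σ : ℝ) (X W : Fin d → ℂ) : ℝ :=
  ∑ j, (γ * (X j).im ^ 2 + Real.pi ^ 2 / γ * (W j).im ^ 2 + 2 * Real.pi * (X j).re * (W j).im +
    σ * |(X j).im| + σ * Real.pi / γ * |(W j).im| + σ ^ 2 / (2 * γ))

/-- Completing the square at $a+\pi\eta/\gamma$ leaves $-\gamma u^2$, where $u$ is the distance of
$s$ to that point up to sign. Half of it pays for the exponential type of $p$ through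
$\sigma|u|\le\sigma^2/(2\gamma)+\gamma u^2/2$. -/
lemma exponent_coordinate_le {γ σ : ℝ} (hγ : 0 < γ) (hσ : 0 < σ) (s a b η : ℝ) :
    σ * (|s - a| + |b|) + (-γ * ((s - a) ^ 2 - b ^ 2) + 2 * Real.pi * η * s) ≤
      γ * b ^ 2 + Real.pi ^ 2 / γ * η ^ 2 + 2 * Real.pi * a * η + σ * |b| +
        σ * Real.pi / γ * |η| + σ ^ 2 / (2 * γ) + (-γ / 2) * (s - (a + Real.pi / γ * η)) ^ 2 := by
  set c := Real.pi / γ * η with hc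
  set u := s - (a + c) with hu
  have h1 : |s - a| ≤ |u| + |c| := by
    have : s - a = u + c := by rw [hu]; ring
    rw [this]; exact abs_add_le _ _
  have h2 : σ * Real.pi / γ * |η| = σ * |c| := by
    rw [hc, abs_mul, abs_of_pos (div_pos Real.pi_pos hγ)]; ring
  have h3 : Real.pi * η = γ * c := by rw [hc]; field_simp
  have h4 : Real.pi ^ 2 / γ * η ^ 2 = γ * c ^ 2 := by rw [hc]; field_simp
  have h5 : σ * |u| ≤ σ ^ 2 / (2 * γ) + γ / 2 * u ^ 2 := by
    have h6 : σ ^ 2 / (2 * γ) + γ / 2 * u ^ 2 - σ * |u| = (σ - γ * |u|) ^ 2 / (2 * γ) := by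
      rw [← sq_abs u]; field_simp; ring
    have h7 : 0 ≤ (σ - γ * |u|) ^ 2 / (2 * γ) := by positivity
    linarith
  have h8 : σ * |s - a| ≤ σ * (|u| + |c|) := by gcongr
  have h9 : s = u + a + c := by rw [hu]; ring
  have h10 : -γ * ((s - a) ^ 2 - b ^ 2) + 2 * Real.pi * η * s =
      γ * b ^ 2 + γ * c ^ 2 + 2 * Real.pi * a * η - γ * u ^ 2 := by
    have : 2 * Real.pi * η * s = 2 * (γ * c) * (u + c) + 2 * Real.pi * a * η := by
      rw [← h3, h9]; ring
    rw [this, h9]; ring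
  rw [h2, h4, h10]
  nlinarith

lemma norm_stftKernel_le {γ : ℝ} (hγ : 0 < γ) {p : (Fin d → ℂ) → ℂ} {σ C : ℝ} (hσ : 0 < σ)
    (hC : 0 < C) (hp : ∀ z : Fin d → ℂ, ‖p z‖ ≤ C * Real.exp (σ * ∑ j, ‖z j‖))
    (X W : Fin d → ℂ) (t : EuclideanSpace ℝ (Fin d)) :
    ‖stftKernel γ p X W t‖ ≤
      C * Real.exp (kernelGrowth γ σ X W) * Real.exp (-γ / 2 * ‖t - kernelCenter γ X W‖ ^ 2) := by
  rw [stftKernel, norm_mul, RCLike.norm_conj, Complex.norm_exp]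
  have h1 : ∀ j, ‖(t j : ℂ) - conj (X j)‖ ≤ |t j - (X j).re| + |(X j).im| := fun j =>
    (Complex.norm_le_abs_re_add_abs_im _).trans (by simp)
  have h2 : (∑ j, (-γ * ((t j : ℂ) - X j) ^ 2 - 2 * Real.pi * Complex.I * (W j * t j))).re =
      ∑ j, (-γ * ((t j - (X j).re) ^ 2 - (X j).im ^ 2) + 2 * Real.pi * (W j).im * t j) := by
    rw [Complex.re_sum]
    refine Finset.sum_congr rfl fun j _ => ?_
    simp [sq]
    ring
  rw [h2]
  calc _ ≤ C * Real.exp (σ * ∑ j, (|t j - (X j).re| + |(X j).im|)) *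
        Real.exp (∑ j, (-γ * ((t j - (X j).re) ^ 2 - (X j).im ^ 2) + 2 * Real.pi * (W j).im * t j)) := by
        refine mul_le_mul_of_nonneg_right ((hp _).trans ?_) (Real.exp_pos _).le
        gcongr with j
        exact h1 j
    _ ≤ _ := by
        rw [mul_assoc, mul_assoc, ← Real.exp_add, ← Real.exp_add]
        refine mul_le_mul_of_nonneg_left (Real.exp_le_exp.2 ?_) hC.le
        rw [Finset.mul_sum, ← Finset.sum_add_distrib, EuclideanSpace.real_norm_sq_eq, kernelGrowth,
          Finset.mul_sum, ← Finset.sum_add_distrib]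
        refine Finset.sum_le_sum fun j _ => ?_
        simpa [kernelCenter] using exponent_coordinate_le hγ hσ (t j) (X j).re (X j).im (W j).im

lemma memLp_gaussian {b : ℝ} (hb : 0 < b) (v : EuclideanSpace ℝ (Fin d)) :
    MemLp (fun t : EuclideanSpace ℝ (Fin d) => Real.exp (-b * ‖t - v‖ ^ 2)) 2 := by
  have h0 : MemLp (fun t : EuclideanSpace ℝ (Fin d) => Real.exp (-b * ‖t‖ ^ 2)) 2 := by
    refine (memLp_two_iff_integrable_sq (Continuous.aestronglyMeasurable (by fun_prop))).2 ?_
    have h := (GaussianFourier.integrable_cexp_neg_mul_sq_norm_add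
      (V := EuclideanSpace ℝ (Fin d)) (b := ((2 * b : ℝ) : ℂ))
      (by rw [Complex.ofReal_re]; positivity) 0 0).norm
    refine h.congr (Filter.Eventually.of_forall fun t => ?_)
    simp only [Complex.norm_exp]
    rw [← Real.exp_nat_mul]
    congr 1
    have : (-((2 * b : ℝ) : ℂ) * (‖t‖ : ℂ) ^ 2 + 0 * ((inner ℝ (0 : EuclideanSpace ℝ (Fin d)) t : ℝ) : ℂ)) =
        ((-(2 * b) * ‖t‖ ^ 2 : ℝ) : ℂ) := by push_cast; ring
    refine (congrArg Complex.re this).trans ?_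
    rw [Complex.ofReal_re]
    push_cast
    ring
  exact h0.comp_measurePreserving (measurePreserving_sub_right volume v)

lemma continuous_stftKernel {γ : ℝ} {p : (Fin d → ℂ) → ℂ} (hp : Continuous p) (X W : Fin d → ℂ) :
    Continuous (stftKernel γ p X W) := by
  unfold stftKernel
  have : Continuous fun t : EuclideanSpace ℝ (Fin d) => p fun j => (t j : ℂ) - conj (X j) := by
    fun_prop
  exact (Complex.continuous_conj.comp this).mul (by fun_prop)

/-- The complexified STFT grows at most like `exp (kernelGrowth γ σ X W)`. -/
lemma exists_norm_stftComplex_le {γ : ℝ} (hγ : 0 < γ) {p : (Fin d → ℂ) → ℂ} {σ C : ℝ} (hσ : 0 < σ)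
    (hC : 0 < C) (hp : ∀ z : Fin d → ℂ, ‖p z‖ ≤ C * Real.exp (σ * ∑ j, ‖z j‖))
    {f : EuclideanSpace ℝ (Fin d) → ℂ} (hf : MemLp f 2) :
    ∃ M : ℝ, 0 ≤ M ∧ ∀ X W, ‖stftComplex γ p f X W‖ ≤ M * Real.exp (kernelGrowth γ σ X W) := by
  have hγ2 : 0 < γ / 2 := by positivity
  have hf2 : Integrable fun t => ‖f t‖ ^ 2 := hf.integrable_norm_pow two_ne_zero
  -- The estimate $|f|g\le|f|^2+g^2$ stands in for Cauchy–Schwarz. By translation invariance the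
  -- Gaussian integral does not depend on the centre, so $I$ serves all $X,W$ at once.
  set I : ℝ := (∫ t, ‖f t‖ ^ 2) +
    ∫ t : EuclideanSpace ℝ (Fin d), Real.exp (-(γ / 2) * ‖t - 0‖ ^ 2) ^ 2 with hI
  have hI0 : 0 ≤ I := by positivity
  refine ⟨C * I, by positivity, fun X W => ?_⟩
  set v := kernelCenter γ X W
  have hg2 : Integrable fun t : EuclideanSpace ℝ (Fin d) => Real.exp (-(γ / 2) * ‖t - v‖ ^ 2) ^ 2 :=
    (memLp_gaussian hγ2 v).integrable_sq
  have hIv : I = ∫ t, (‖f t‖ ^ 2 + Real.exp (-(γ / 2) * ‖t - v‖ ^ 2) ^ 2) := by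
    rw [integral_add hf2 hg2, hI]
    congr 1
    rw [integral_sub_right_eq_self (fun t : EuclideanSpace ℝ (Fin d) =>
      Real.exp (-(γ / 2) * ‖t‖ ^ 2) ^ 2) v]
    simp
  rw [stftComplex]
  calc _ ≤ ∫ t, C * Real.exp (kernelGrowth γ σ X W) *
        (‖f t‖ ^ 2 + Real.exp (-(γ / 2) * ‖t - v‖ ^ 2) ^ 2) := by
        refine norm_integral_le_of_norm_le ((hf2.add hg2).const_mul _)
          (Filter.Eventually.of_forall fun t => ?_)
        rw [norm_mul]
        have h1 := norm_stftKernel_le hγ hσ hC hp X W t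
        have h2 : -γ / 2 = -(γ / 2) := by ring
        rw [h2] at h1
        have h3 : ‖f t‖ * Real.exp (-(γ / 2) * ‖t - v‖ ^ 2) ≤
            ‖f t‖ ^ 2 + Real.exp (-(γ / 2) * ‖t - v‖ ^ 2) ^ 2 := by
          nlinarith [sq_nonneg (‖f t‖ - Real.exp (-(γ / 2) * ‖t - v‖ ^ 2)), sq_nonneg (‖f t‖),
            sq_nonneg (Real.exp (-(γ / 2) * ‖t - v‖ ^ 2))]
        calc _ ≤ ‖f t‖ * (C * Real.exp (kernelGrowth γ σ X W) *
              Real.exp (-(γ / 2) * ‖t - v‖ ^ 2)) := by gcongr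
          _ = C * Real.exp (kernelGrowth γ σ X W) *
              (‖f t‖ * Real.exp (-(γ / 2) * ‖t - v‖ ^ 2)) := by ring
          _ ≤ _ := by gcongr
    _ = _ := by rw [integral_const_mul, ← hIv]; ring

/-- The complexified STFT is entire along complex lines. -/
lemma differentiable_stftComplex_line {γ : ℝ} (hγ : 0 < γ) {p : (Fin d → ℂ) → ℂ}
    (hp : IsEntireOfExpType p) {f : EuclideanSpace ℝ (Fin d) → ℂ} (hf : MemLp f 2)
    (X U W Y : Fin d → ℂ) :
    Differentiable ℂ fun z : ℂ => stftComplex γ p f (fun j => X j + z * U j) (fun j => W j + z * Y j) := by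
  obtain ⟨hpd, σ, hσ, C, hC, hpC⟩ := hp
  refine differentiable_integral_of_locally_dominated (fun t => ?_) (fun z => ?_) (fun R => ?_)
  · refine (differentiable_const _).mul ?_
    unfold stftKernel
    refine Differentiable.mul ?_ (by fun_prop)
    -- Conjugating both the argument and the value of this holomorphic function gives the window
    -- factor of the kernel, which is therefore holomorphic in $z$.
    have h1 : Differentiable ℂ fun w : ℂ => p fun j => (t j : ℂ) - conj (X j) - w * conj (U j) := by
      fun_prop
    intro z
    have h2 := (h1 (conj z)).conj_conj
    rw [Complex.conj_conj] at h2
    refine h2.congr_of_eventuallyEq (Filter.Eventually.of_forall fun w => ?_)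
    simp [sub_sub]
  · exact hf.1.mul (continuous_stftKernel hpd.continuous _ _).aestronglyMeasurable
  · have hcont : Continuous fun z : ℂ =>
        kernelGrowth γ σ (fun j => X j + z * U j) (fun j => W j + z * Y j) +
          γ / 2 * ‖kernelCenter γ (fun j => X j + z * U j) (fun j => W j + z * Y j)‖ ^ 2 := by
      unfold kernelGrowth kernelCenter
      fun_prop
    obtain ⟨M, hM⟩ := ((isCompact_closedBall (0 : ℂ) R).image hcont).bddAbove
    have hγ4 : 0 < γ / 4 := by positivity
    refine ⟨fun t => C * Real.exp M * (‖f t‖ * Real.exp (-(γ / 4) * ‖t - 0‖ ^ 2)),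
      (hf.norm.integrable_mul (memLp_gaussian hγ4 0)).const_mul _, fun z hz t => ?_⟩
    have hMz := hM (Set.mem_image_of_mem _ (mem_closedBall_zero_iff.2 hz))
    have h1 := norm_stftKernel_le hγ hσ hC hpC (fun j => X j + z * U j) (fun j => W j + z * Y j) t
    set v := kernelCenter γ (fun j => X j + z * U j) (fun j => W j + z * Y j)
    set G := kernelGrowth γ σ (fun j => X j + z * U j) (fun j => W j + z * Y j)
    rw [norm_mul]
    simp only [sub_zero]
    -- The moving Gaussian is compared with one centred at $0$, at the cost of half the exponent and
    -- a factor $e^{\gamma\|v\|^2/2}$, which the choice of $M$ includes.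
    have h2 : ‖t‖ ^ 2 ≤ 2 * ‖t - v‖ ^ 2 + 2 * ‖v‖ ^ 2 := by
      have h3 : ‖t‖ ≤ ‖t - v‖ + ‖v‖ := by simpa using norm_add_le (t - v) v
      nlinarith [norm_nonneg t, sq_nonneg (‖t - v‖ - ‖v‖)]
    have h4 : Real.exp G * Real.exp (-γ / 2 * ‖t - v‖ ^ 2) ≤
        Real.exp M * Real.exp (-(γ / 4) * ‖t‖ ^ 2) := by
      rw [← Real.exp_add, ← Real.exp_add]
      refine Real.exp_le_exp.2 ?_
      have h5 := mul_le_mul_of_nonneg_left h2 hγ4.le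
      linarith
    calc _ ≤ ‖f t‖ * (C * Real.exp G * Real.exp (-γ / 2 * ‖t - v‖ ^ 2)) := by gcongr
      _ = C * ‖f t‖ * (Real.exp G * Real.exp (-γ / 2 * ‖t - v‖ ^ 2)) := by ring
      _ ≤ C * ‖f t‖ * (Real.exp M * Real.exp (-(γ / 4) * ‖t‖ ^ 2)) := by gcongr
      _ = _ := by ring

end ComplexifiedSTFT

/-! ### Integrability of the window and nonvanishing of its ambiguity function. -/

section WindowProperties

open scoped ComplexConjugate FourierTransform

variable {d : ℕ}

lemma continuous_gaussWindow {γ : ℝ} {p : (Fin d → ℂ) → ℂ} (hp : Continuous p) :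
    Continuous (gaussWindow γ p) := by
  unfold gaussWindow
  fun_prop

lemma memLp_gaussWindow {γ : ℝ} (hγ : 0 < γ) {p : (Fin d → ℂ) → ℂ} (hp : IsEntireOfExpType p) :
    MemLp (gaussWindow γ p) 2 := by
  have hcont := continuous_gaussWindow (γ := γ) hp.1.continuous
  obtain ⟨-, σ, hσ, C, hC, hpC⟩ := hp
  have hγ2 : 0 < γ / 2 := by positivity
  refine ((memLp_gaussian hγ2 (0 : EuclideanSpace ℝ (Fin d))).const_mul
    (C * Real.exp (kernelGrowth γ σ (0 : Fin d → ℂ) 0))).mono' hcont.aestronglyMeasurable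
    (Filter.Eventually.of_forall fun t => ?_)
  have h1 := norm_stftKernel_le hγ hσ hC hpC 0 0 t
  have h2 : kernelCenter γ (0 : Fin d → ℂ) 0 = 0 := by
    ext j; simp [kernelCenter]
  rw [h2] at h1
  have h3 : ‖gaussWindow γ p t‖ = ‖stftKernel γ p 0 0 t‖ := by
    rw [gaussWindow, stftKernel, norm_mul, norm_mul, RCLike.norm_conj, EuclideanSpace.real_norm_sq_eq,
      Finset.mul_sum]
    simp
  rw [h3, ← neg_div]
  exact h1

lemma dense_gaussWindow_ne_zero {γ : ℝ} {p : (Fin d → ℂ) → ℂ} (hp : Differentiable ℂ p)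
    (hp0 : p ≠ 0) : Dense {x | gaussWindow γ p x ≠ 0} := by
  have h1 : Dense {x : EuclideanSpace ℝ (Fin d) | p (fun j => (x j : ℂ)) ≠ 0} := by
    refine dense_ne_zero_of_entire_lines (fun x v => ⟨fun z => p fun j => x j + z * v j, ?_, ?_⟩) ?_
    · fun_prop
    · intro r
      simp
    · obtain ⟨z, hz⟩ := Function.ne_iff.1 hp0
      by_contra! h
      -- The line $w\mapsto\operatorname{Re}z+w\operatorname{Im}z$ is real for real $w$ and passes
      -- through $z$ at $w=i$, so vanishing on $\mathbb R^d$ would give $p(z)=0$.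
      have hg : Differentiable ℂ fun w : ℂ => p fun j => (z j).re + w * (z j).im := by fun_prop
      have h2 := eq_zero_of_eventually_real hg (Filter.Eventually.of_forall fun r => by
        simpa using h (WithLp.toLp 2 fun j => (z j).re + r * (z j).im))
      apply hz
      have h3 := congrFun h2 Complex.I
      simpa [mul_comm Complex.I, Complex.re_add_im] using h3
  simpa [gaussWindow] using h1

/-- If this function of $\omega$ vanished identically, Fourier injectivity and continuity would give
$\varphi(y-s)\overline{\varphi(y)}=0$ everywhere. But the nonvanishing sets of the two factors are
dense, one of them open, hence they meet. -/
lemma dense_stft_gaussWindow_translate_ne_zero {γ : ℝ} (hγ : 0 < γ) {p : (Fin d → ℂ) → ℂ}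
    (hp : IsEntireOfExpType p) (hp0 : p ≠ 0) (s : EuclideanSpace ℝ (Fin d)) :
    Dense {ω | stft (gaussWindow γ p) (fun y => gaussWindow γ p (y - s)) (0, ω) ≠ 0} := by
  set φ := gaussWindow γ p with hφ
  have hφL : MemLp φ 2 := memLp_gaussWindow hγ hp
  have hφc : Continuous φ := continuous_gaussWindow hp.1.continuous
  have hφs : MemLp (fun y => φ (y - s)) 2 :=
    hφL.comp_measurePreserving (measurePreserving_sub_right volume s)
  refine dense_ne_zero_of_entire_lines (fun x v => ⟨_, differentiable_stftComplex_line hγ hp hφs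
    0 0 (fun j => (x j : ℂ)) (fun j => (v j : ℂ)), fun r => ?_⟩) ?_
  · rw [hφ, ← stftComplex_ofReal]
    simp
  · by_contra! h
    have hint : Integrable (fun y => φ (y - s) * conj (φ (y - 0))) :=
      integrable_mul_conj_comp_sub_right hφs hφL 0
    have h1 : (fun y => φ (y - s) * conj (φ (y - 0))) =ᵐ[volume] fun _ => (0 : ℂ) := by
      refine ae_eq_of_fourier_eq hint (integrable_zero _ _ _) fun ω => ?_
      rw [← stft_eq_fourier, h, Real.fourier_eq']
      simp
    have h2 : (fun y => φ (y - s) * conj (φ (y - 0))) = fun _ => (0 : ℂ) := by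
      refine (Continuous.ae_eq_iff_eq volume ?_ continuous_const).1 h1
      exact (hφc.comp (by fun_prop)).mul (Complex.continuous_conj.comp (hφc.comp (by fun_prop)))
    have hd : Dense {x | φ x ≠ 0} := dense_gaussWindow_ne_zero hp.1 hp0
    have ho : IsOpen {x | φ x ≠ 0} := isOpen_ne_fun hφc continuous_const
    have hds : Dense {x | φ (x - s) ≠ 0} :=
      hd.preimage (Homeomorph.subRight s).isOpenMap
    obtain ⟨y, hy1, hy2⟩ := (hd.inter_of_isOpen_left hds ho).nonempty
    have h3 := congrFun h2 y
    simp only [sub_zero, mul_eq_zero, map_eq_zero] at h3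
    exact h3.elim hy2 hy1

end WindowProperties

/-! ### From the square-root lattice to the full spectrogram. -/

section Sampling

open scoped ComplexConjugate

variable {d : ℕ}

/-- A property of real vectors that propagates along each coordinate from `S` to `ℝ` propagates from
the grid with coordinates in `S` to all vectors. -/
lemma forall_of_forall_coordinate {ι : Type*} [Fintype ι] [DecidableEq ι] {S : Set ℝ}
    {P : (ι → ℝ) → Prop}
    (h : ∀ (x : ι → ℝ) (j : ι), (∀ s ∈ S, P (x + Pi.single j s)) →
      ∀ r : ℝ, P (x + Pi.single j r))
    (h0 : ∀ x, (∀ j, x j ∈ S) → P x) (x : ι → ℝ) : P x := by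
  -- Induction on the set $T$ of coordinates that are freed from $S$.
  have key : ∀ (T : Finset ι) (x : ι → ℝ), (∀ j ∉ T, x j ∈ S) → P x := by
    intro T
    induction T using Finset.induction_on with
    | empty => exact fun x hx => h0 x fun j => hx j (by simp)
    | insert i T _ ih =>
      intro x hx
      have h1 := h (Function.update x i 0) i (fun s hs => ih _ fun j hj => ?_) (x i)
      · convert h1 using 1
        ext k
        by_cases hk : k = i
        · subst hk; simp
        · simp [hk]
      · by_cases hji : j = i
        · subst hji; simpa using hs
        · simpa [hji] using hx j (by simp [hji, hj])
  exact key Finset.univ x (by simp)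

/-- The mixed term $2\pi\operatorname{Re}X\operatorname{Im}W$ is odd under $z\mapsto\bar z$ and
cancels in the sum. Only coordinate $j$ moves, so the quadratic rate does not depend on $d$. -/
lemma kernelGrowth_add_kernelGrowth_conj {γ σ : ℝ} (x ω : Fin d → ℝ) (j : Fin d)
    (u y : ℝ) (z : ℂ) :
    kernelGrowth γ σ (fun k => (x k : ℂ) + z * (Pi.single j u : Fin d → ℝ) k)
        (fun k => (ω k : ℂ) + z * (Pi.single j y : Fin d → ℝ) k) +
      kernelGrowth γ σ (fun k => (x k : ℂ) + conj z * (Pi.single j u : Fin d → ℝ) k)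
        (fun k => (ω k : ℂ) + conj z * (Pi.single j y : Fin d → ℝ) k) =
      2 * (γ * u ^ 2 + Real.pi ^ 2 / γ * y ^ 2) * z.im ^ 2 +
        2 * (σ * |u| + σ * Real.pi / γ * |y|) * |z.im| + d * (σ ^ 2 / γ) := by
  have hs : ∀ k, (γ * (z.im * (Pi.single j u : Fin d → ℝ) k) ^ 2 +
      Real.pi ^ 2 / γ * (z.im * (Pi.single j y : Fin d → ℝ) k) ^ 2 +
      σ * (|z.im| * |(Pi.single j u : Fin d → ℝ) k|) +
      σ * Real.pi / γ * (|z.im| * |(Pi.single j y : Fin d → ℝ) k|)) =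
      (Pi.single j (γ * (z.im * u) ^ 2 + Real.pi ^ 2 / γ * (z.im * y) ^ 2 +
        σ * (|z.im| * |u|) + σ * Real.pi / γ * (|z.im| * |y|)) : Fin d → ℝ) k := by
    intro k
    by_cases hk : k = j
    · subst hk; simp
    · simp [hk]
  have hsum : ∑ k, (Pi.single j (γ * (z.im * u) ^ 2 + Real.pi ^ 2 / γ * (z.im * y) ^ 2 +
        σ * (|z.im| * |u|) + σ * Real.pi / γ * (|z.im| * |y|)) : Fin d → ℝ) k = _ :=
    Finset.sum_pi_single' j _ Finset.univ |>.trans (by simp; rfl)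
  have hconst : (d : ℝ) * (σ ^ 2 / γ) = ∑ _k : Fin d, σ ^ 2 / γ := by simp
  have hrhs : 2 * (γ * u ^ 2 + Real.pi ^ 2 / γ * y ^ 2) * z.im ^ 2 +
        2 * (σ * |u| + σ * Real.pi / γ * |y|) * |z.im| + d * (σ ^ 2 / γ) =
      2 * (γ * (z.im * u) ^ 2 + Real.pi ^ 2 / γ * (z.im * y) ^ 2 +
        σ * (|z.im| * |u|) + σ * Real.pi / γ * (|z.im| * |y|)) + d * (σ ^ 2 / γ) := by ring
  rw [hrhs, ← hsum, hconst, kernelGrowth, kernelGrowth, ← Finset.sum_add_distrib, Finset.mul_sum,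
    ← Finset.sum_add_distrib]
  refine Finset.sum_congr rfl fun k _ => ?_
  rw [← hs k]
  simp only [Complex.add_im, Complex.add_re, Complex.mul_im, Complex.mul_re, Complex.ofReal_im,
    Complex.ofReal_re, Complex.conj_im, Complex.conj_re, mul_zero, zero_add, sub_zero,
    abs_mul, abs_neg]
  ring

/-- Along each coordinate direction, agreement of the spectrograms on a sufficiently dense
square-root lattice implies agreement everywhere. -/
lemma norm_stft_eq_of_eq_on_sqrt_lattice {γ : ℝ} (hγ : 0 < γ) {p : (Fin d → ℂ) → ℂ}
    (hp : IsEntireOfExpType p) {f h : EuclideanSpace ℝ (Fin d) → ℂ} (hf : MemLp f 2)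
    (hh : MemLp h 2) (x ω : Fin d → ℝ) (j : Fin d) (u y : ℝ) {a : ℝ} (ha : 0 < a)
    (hA : Real.exp 1 * (2 * (γ * u ^ 2 + Real.pi ^ 2 / γ * y ^ 2)) * a ^ 2 < 1)
    (H : ∀ s ∈ a • sqrtInt,
      ‖stft (gaussWindow γ p) f
        (WithLp.toLp 2 (x + Pi.single j (s * u)), WithLp.toLp 2 (ω + Pi.single j (s * y)))‖ =
      ‖stft (gaussWindow γ p) h
        (WithLp.toLp 2 (x + Pi.single j (s * u)), WithLp.toLp 2 (ω + Pi.single j (s * y)))‖)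
    (r : ℝ) :
    ‖stft (gaussWindow γ p) f
        (WithLp.toLp 2 (x + Pi.single j (r * u)), WithLp.toLp 2 (ω + Pi.single j (r * y)))‖ =
      ‖stft (gaussWindow γ p) h
        (WithLp.toLp 2 (x + Pi.single j (r * u)), WithLp.toLp 2 (ω + Pi.single j (r * y)))‖ := by
  obtain ⟨-, σ, hσ, C, hC, hpC⟩ := id hp
  set A := 2 * (γ * u ^ 2 + Real.pi ^ 2 / γ * y ^ 2) with hAdef
  have hA0 : 0 ≤ A := by positivity
  set B := 2 * (σ * |u| + σ * Real.pi / γ * |y|) with hBdef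
  have hB0 : 0 ≤ B := by positivity
  set V : (EuclideanSpace ℝ (Fin d) → ℂ) → ℂ → ℂ := fun g z =>
    stftComplex γ p g (fun k => (x k : ℂ) + z * (Pi.single j u : Fin d → ℝ) k)
      (fun k => (ω k : ℂ) + z * (Pi.single j y : Fin d → ℝ) k) with hV
  -- The reflected product is entire, unlike $|V|^2$ itself, and agrees with it on the real axis.
  have hVd : ∀ {g}, MemLp g 2 → Differentiable ℂ fun z => V g z * conj (V g (conj z)) := by
    intro g hg
    have h1 : Differentiable ℂ (V g) := differentiable_stftComplex_line hγ hp hg _ _ _ _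
    refine h1.mul fun z => ?_
    have h2 := (h1 (conj z)).conj_conj
    rw [Complex.conj_conj] at h2
    exact h2
  have hVb : ∀ {g}, MemLp g 2 → ∃ K, ∀ z, ‖V g z * conj (V g (conj z))‖ ≤
      K * Real.exp (A * ‖z‖ ^ 2 + B * ‖z‖) := by
    intro g hg
    obtain ⟨M, hM0, hM⟩ := exists_norm_stftComplex_le hγ hσ hC hpC hg
    refine ⟨M ^ 2 * Real.exp (d * (σ ^ 2 / γ)), fun z => ?_⟩
    rw [norm_mul, RCLike.norm_conj]
    refine (mul_le_mul (hM _ _) (hM _ _) (norm_nonneg _) (by positivity)).trans ?_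
    rw [mul_mul_mul_comm, ← Real.exp_add, kernelGrowth_add_kernelGrowth_conj, ← sq,
      mul_assoc (M ^ 2), ← Real.exp_add]
    refine mul_le_mul_of_nonneg_left (Real.exp_le_exp.2 ?_) (by positivity)
    have h3 : |z.im| ≤ ‖z‖ := Complex.abs_im_le_norm z
    have h4 : z.im ^ 2 ≤ ‖z‖ ^ 2 := by
      rw [← sq_abs]; gcongr
    have h5 := mul_le_mul_of_nonneg_left h4 hA0
    have h6 := mul_le_mul_of_nonneg_left h3 hB0
    linarith
  have hVr : ∀ g (s : ℝ), V g s * conj (V g (conj (s : ℂ))) =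
      ((‖stft (gaussWindow γ p) g (WithLp.toLp 2 (x + Pi.single j (s * u)),
        WithLp.toLp 2 (ω + Pi.single j (s * y)))‖ ^ 2 : ℝ) : ℂ) := by
    intro g s
    rw [Complex.conj_ofReal, Complex.mul_conj, Complex.normSq_eq_norm_sq, ← stftComplex_ofReal]
    have hsing : ∀ w : ℝ, ∀ k, (Pi.single j (s * w) : Fin d → ℝ) k =
        s * (Pi.single j w : Fin d → ℝ) k := by
      intro w k
      by_cases hk : k = j
      · subst hk; simp
      · simp [hk]
    simp [hV, hsing]
  obtain ⟨K₁, hK₁⟩ := hVb hf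
  obtain ⟨K₂, hK₂⟩ := hVb hh
  have hzero : ∀ s ∈ a • sqrtInt, V f (s : ℝ) * conj (V f (conj ((s : ℝ) : ℂ))) -
      V h (s : ℝ) * conj (V h (conj ((s : ℝ) : ℂ))) = 0 := by
    intro s hs
    rw [hVr, hVr, H s hs, sub_self]
  have hfin := eq_zero_of_zeros_of_growth
    (f := fun z => V f z * conj (V f (conj z)) - V h z * conj (V h (conj z)))
    ((hVd hf).sub (hVd hh)) ha (K := K₁ + K₂) (A := A) (B := B)
    (fun n => hzero _ ⟨√n, ⟨n, Or.inl rfl⟩, rfl⟩)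
    (fun n => hzero _ ⟨-√n, ⟨n, Or.inr rfl⟩, by simp⟩) hA
    (fun z => by
      rw [add_mul]
      exact (norm_sub_le _ _).trans (add_le_add (hK₁ z) (hK₂ z))) (r : ℂ)
  simp only [hVr] at hfin
  rw [← Complex.ofReal_sub, Complex.ofReal_eq_zero, sub_eq_zero] at hfin
  exact (sq_eq_sq₀ (norm_nonneg _) (norm_nonneg _)).1 hfin

lemma toLp_mem_smul_sqrtIntPow {a : ℝ} {x : Fin d → ℝ} (hx : ∀ j, x j ∈ a • sqrtInt) :
    WithLp.toLp 2 x ∈ a • sqrtIntPow d := by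
  choose s hs hsx using hx
  refine ⟨WithLp.toLp 2 s, hs, ?_⟩
  ext j
  simpa using hsx j

/-- Agreement of the spectrograms on the square-root lattice implies agreement everywhere. -/
lemma norm_stft_eq_of_eq_on_sqrtIntPow {γ : ℝ} (hγ : 0 < γ) {p : (Fin d → ℂ) → ℂ}
    (hp : IsEntireOfExpType p) {f h : EuclideanSpace ℝ (Fin d) → ℂ} (hf : MemLp f 2)
    (hh : MemLp h 2) {α β : ℝ} (hα0 : 0 < α) (hβ0 : 0 < β)
    (hα : α < √(1 / (2 * γ * Real.exp 1)))
    (hβ : β < √(γ / (2 * Real.pi ^ 2 * Real.exp 1)))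
    (H : ∀ q ∈ (α • sqrtIntPow d) ×ˢ (β • sqrtIntPow d),
      ‖stft (gaussWindow γ p) f q‖ = ‖stft (gaussWindow γ p) h q‖)
    (x ω : EuclideanSpace ℝ (Fin d)) :
    ‖stft (gaussWindow γ p) f (x, ω)‖ = ‖stft (gaussWindow γ p) h (x, ω)‖ := by
  -- The hypotheses on $\alpha$ and $\beta$ are exactly $eAa^2<1$ for the time direction
  -- $(u,y)=(1,0)$ and the frequency direction $(0,1)$.
  have hα' : Real.exp 1 * (2 * (γ * 1 ^ 2 + Real.pi ^ 2 / γ * 0 ^ 2)) * α ^ 2 < 1 := by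
    have h1 := (Real.lt_sqrt hα0.le).1 hα
    rw [lt_div_iff₀ (by positivity)] at h1
    linarith
  have hβ' : Real.exp 1 * (2 * (γ * 0 ^ 2 + Real.pi ^ 2 / γ * 1 ^ 2)) * β ^ 2 < 1 := by
    have h1 := (Real.lt_sqrt hβ0.le).1 hβ
    rw [lt_div_iff₀ (by positivity)] at h1
    have h2 : Real.exp 1 * (2 * (γ * 0 ^ 2 + Real.pi ^ 2 / γ * 1 ^ 2)) * β ^ 2 =
        β ^ 2 * (2 * Real.pi ^ 2 * Real.exp 1) / γ := by ring
    rwa [h2, div_lt_one hγ]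
  -- Time coordinates are freed first, with the frequency still on its lattice; the frequency
  -- coordinates follow for arbitrary time.
  have hx : ∀ ω : Fin d → ℝ, (∀ j, ω j ∈ β • sqrtInt) → ∀ x : Fin d → ℝ,
      ‖stft (gaussWindow γ p) f (WithLp.toLp 2 x, WithLp.toLp 2 ω)‖ =
        ‖stft (gaussWindow γ p) h (WithLp.toLp 2 x, WithLp.toLp 2 ω)‖ := by
    intro ω hω
    refine forall_of_forall_coordinate (S := α • sqrtInt) (fun x j hS r => ?_) (fun x hx => ?_)
    · have := norm_stft_eq_of_eq_on_sqrt_lattice hγ hp hf hh x ω j 1 0 hα0 hα'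
        (fun s hs => by simpa using hS s hs) r
      simpa using this
    · exact H _ ⟨toLp_mem_smul_sqrtIntPow hx, toLp_mem_smul_sqrtIntPow hω⟩
  have hω : ∀ x ω : Fin d → ℝ,
      ‖stft (gaussWindow γ p) f (WithLp.toLp 2 x, WithLp.toLp 2 ω)‖ =
        ‖stft (gaussWindow γ p) h (WithLp.toLp 2 x, WithLp.toLp 2 ω)‖ := by
    intro x
    refine forall_of_forall_coordinate (S := β • sqrtInt) (fun ω j hS r => ?_)
      (fun ω hω => hx ω hω x)
    have := norm_stft_eq_of_eq_on_sqrt_lattice hγ hp hf hh x ω j 0 1 hβ0 hβ'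
      (fun s hs => by simpa using hS s hs) r
    simpa using this
  exact hω x.ofLp ω.ofLp

end Sampling

/-! ### The equivalence. -/

lemma stft_congr_smul {d : ℕ} {g f h : EuclideanSpace ℝ (Fin d) → ℂ} {τ : ℂ}
    (hfh : f =ᵐ[volume] fun t => τ * h t)
    (q : EuclideanSpace ℝ (Fin d) × EuclideanSpace ℝ (Fin d)) :
    stft g f q = τ * stft g h q := by
  rw [stft, stft, ← integral_const_mul]
  refine integral_congr_ae ?_
  filter_upwards [hfh] with t ht
  rw [ht]
  ring

theorem corollary2 (d : ℕ) (γ : ℝ) (hγ : 0 < γ)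
    (p : (Fin d → ℂ) → ℂ) (hp : IsEntireOfExpType p) (hp0 : p ≠ 0)
    (α β : ℝ) (hα0 : 0 < α) (hβ0 : 0 < β)
    (hα : α < √(1 / (2 * γ * Real.exp 1)))
    (hβ : β < √(γ / (2 * Real.pi ^ 2 * Real.exp 1))) :
    MemLp (gaussWindow γ p) 2 (volume : Measure (EuclideanSpace ℝ (Fin d))) ∧
    ∀ f h : Lp ℂ 2 (volume : Measure (EuclideanSpace ℝ (Fin d))),
      (∀ q ∈ (α • sqrtIntPow d) ×ˢ (β • sqrtIntPow d),
          ‖stft (gaussWindow γ p) f q‖ = ‖stft (gaussWindow γ p) h q‖) ↔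
        AgreeUpToPhase f h := by
  refine ⟨memLp_gaussWindow hγ hp, fun f h => ⟨fun H => ?_, ?_⟩⟩
  · obtain ⟨τ, hτ, hfh⟩ := exists_phase_of_norm_stft_eq
      (continuous_gaussWindow hp.1.continuous).stronglyMeasurable
      (Lp.stronglyMeasurable f) (Lp.stronglyMeasurable h) (memLp_gaussWindow hγ hp)
      (Lp.memLp f) (Lp.memLp h) (dense_stft_gaussWindow_translate_ne_zero hγ hp hp0)
      (norm_stft_eq_of_eq_on_sqrtIntPow hγ hp (Lp.memLp f) (Lp.memLp h) hα0 hβ0 hα hβ H)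
    refine ⟨τ, hτ, Lp.ext ?_⟩
    filter_upwards [hfh, Lp.coeFn_smul τ h] with t h1 h2
    rw [h1, h2, Pi.smul_apply, smul_eq_mul]
  · rintro ⟨τ, hτ, rfl⟩ q -
    rw [stft_congr_smul (Lp.coeFn_smul τ h), norm_mul, hτ, one_mul]
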